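/- **Proposition.** Let $d\ge 1$ and let $D\subset\mathbb{R}^d$ be a bounded domain with Lipschitz boundary (for instance, a bounded domain with smooth boundary). Let $da$ denote the surface measure on $\partial D$, and let $\partial D=\Gamma_1\cup\Gamma_2\cup\Gamma_3$ with $\Gamma_1,\Gamma_2,\Gamma_3$ measurable, pairwise disjoint and $\mathrm{meas}(\Gamma_1)>0$. Let $$V=\{v\in H^1(D): v=0\ \text{on}\ \Gamma_1\}$$ (in the sense of traces), endowed with the inner product of $H^1(D)$, let $V^*$ be its dual and $\langle\cdot,\cdot\rangle$ the duality pairing. Let $b\in L^2(\Gamma_2)$ be such that there exists $u_b\in V$ with $u_b\ge 0$ a.e. in $D$ and $u_b=b$ a.e. on $\Gamma_2$. Let $p_2:\Gamma_2\times\mathbb{R}\to\mathbb{R}$ satisfy: (a) there is $L_2>0$ such that, for a.e. $x\in\Gamma_2$, $|p_2(x,r)-p_2(x,s)|\le L_2|r-s|$ for all $r,s\in\mathbb{R}$; (b) for a.e. $x\in\Gamma_2$, $(p_2(x,r)-p_2(x,s))(r-s)\ge 0$ for all $r,s\in\mathbb{R}$; (c) $x\mapsto p_2(x,r)$ is measurable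 on $\Gamma_2$ for every $r\in\mathbb{R}$; (d) for a.e. $x\in\Gamma_2$, for all $r\in\mathbb{R}$: $p_2(x,r)=0$ if and only if $r=0$. Set $$K=\{v\in V: v\ge 0\ \text{a.e. in}\ D,\ v=b\ \text{a.e. on}\ \Gamma_2\},\qquad \widetilde K=\{v\in V: v\ge 0\ \text{a.e. in}\ D\}.$$ Then: 1. $\widetilde K$ is a closed convex subset of $V$, and $K\subset\widetilde K$. 2. The formula $$\langle Gu,v\rangle=\int_{\Gamma_2}p_2(x,u(x)-b(x))\,v(x)\,da\qquad\forall\,u,v\in V$$ (the integrand being integrable for all $u,v\in V$) defines an operator $G:V\to V^*$ such that - $G$ is bounded (it maps bounded sets of $V$ into bounded sets of $V^*$), demicontinuous ($u_n\to u$ in $V$ implies $Gu_n\rightharpoonup Gu$ weakly in $V^*$) and monotone ($\langle Gu-Gv,u-v\rangle\ge 0$ for all $u,v\in V$); - $\langle Gu,v-u\rangle\le 0$ for all $u\in\widetilde K$ and $v\in K$; - if $u\in\widetilde K$ and $\langle Gu,v-u\rangle=0$ for all $v\in K$, then $u\in K$. -/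

import Mathlib

open MeasureTheory Filter Topology Set
open scoped ENNReal NNReal ContDiff

noncomputable section

namespace HeatTransfer

/-! ### Domains, surface measure, decomposition of the boundary -/

/-- The Euclidean space `ℝ^d`. -/
abbrev E (d : ℕ) : Type := EuclideanSpace ℝ (Fin d)

/-- A bounded Lipschitz domain: a bounded, connected, nonempty open set which, near each of its
boundary points, is the region strictly above the graph of a Lipschitz function of the
variables orthogonal to some unit vector `ξ`. Bounded domains with smooth boundary and boxes
are of this kind. -/
structure IsBoundedLipschitzDomain {d : ℕ} (D : Set (E d)) : Prop where
  isOpen : IsOpen D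
  isConnected : IsConnected D
  isBounded : Bornology.IsBounded D
  graph : ∀ x₀ ∈ frontier D, ∃ (ξ : E d) (r : ℝ) (L : ℝ≥0) (g : ((ℝ ∙ ξ)ᗮ : Submodule ℝ (E d)) → ℝ),
    ‖ξ‖ = 1 ∧ 0 < r ∧ LipschitzWith L g ∧
      ∀ x ∈ Metric.ball x₀ r,
        (x ∈ D ↔ g ((ℝ ∙ ξ)ᗮ.orthogonalProjectionOnto x) < inner ℝ ξ x)

/-- Surface measure `da` on `∂D`: the (Lebesgue-normalised) `(d-1)`-dimensional Hausdorff measure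
restricted to the boundary. -/
def surfaceMeasure {d : ℕ} (D : Set (E d)) : Measure (E d) :=
  (Measure.euclideanHausdorffMeasure (d - 1) : Measure (E d)).restrict (frontier D)

/-- `∂D` is the disjoint union of the measurable sets `Γ₁, Γ₂, Γ₃`, and `meas Γ₁ > 0`. -/
structure IsBoundaryPartition {d : ℕ} (D Γ₁ Γ₂ Γ₃ : Set (E d)) : Prop where
  union_eq : Γ₁ ∪ Γ₂ ∪ Γ₃ = frontier D
  disjoint₁₂ : Disjoint Γ₁ Γ₂
  disjoint₁₃ : Disjoint Γ₁ Γ₃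
  disjoint₂₃ : Disjoint Γ₂ Γ₃
  measurable₁ : NullMeasurableSet Γ₁ (surfaceMeasure D)
  measurable₂ : NullMeasurableSet Γ₂ (surfaceMeasure D)
  measurable₃ : NullMeasurableSet Γ₃ (surfaceMeasure D)
  pos₁ : 0 < surfaceMeasure D Γ₁

/-! ### The Sobolev space `H¹(D)` -/

/-- `w` is the weak gradient of `u` on `D`:
`∫_D u ∂_e φ = - ∫_D (w · e) φ` for all test functions `φ ∈ C_c^∞(D)` and all directions `e`. -/
def IsWeakGradient {d : ℕ} (D : Set (E d)) (u : E d → ℝ) (w : E d → E d) : Prop :=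
  ∀ φ : E d → ℝ, ContDiff ℝ ∞ φ → HasCompactSupport φ → tsupport φ ⊆ D → ∀ e : E d,
    ∫ x in D, u x * fderiv ℝ φ x e = - ∫ x in D, inner ℝ (w x) e * φ x

/-- The Hilbert space `L²(D) × L²(D)^d`. -/
abbrev L2Pair {d : ℕ} (D : Set (E d)) : Type :=
  WithLp 2 (Lp ℝ 2 (volume.restrict D) × Lp (E d) 2 (volume.restrict D))

theorem memLp_test {d : ℕ} {φ : E d → ℝ} (hφ : Continuous φ) (hc : HasCompactSupport φ)
    (D : Set (E d)) : MemLp φ 2 (volume.restrict D) :=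
  (hφ.memLp_of_hasCompactSupport hc).restrict D

theorem memLp_fderiv_test {d : ℕ} {φ : E d → ℝ} (hφ : ContDiff ℝ ∞ φ) (hc : HasCompactSupport φ)
    (D : Set (E d)) (e : E d) : MemLp (fun x => fderiv ℝ φ x e) 2 (volume.restrict D) :=
  memLp_test ((hφ.continuous_fderiv (by simp)).clm_apply continuous_const) (hc.fderiv_apply ℝ e) D

/-- `H¹(D)`, realised as the set of pairs `(u, ∇u)` with `u ∈ L²(D)` and weak gradient
`∇u ∈ L²(D)^d` (the weak gradient is determined by `u`). The inner product inherited from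
`L²(D) × L²(D)^d` is the usual one, `∫_D u v + ∫_D ∇u · ∇v`. -/
def H1 {d : ℕ} (D : Set (E d)) : Submodule ℝ (L2Pair D) where
  carrier := {p | IsWeakGradient D p.fst p.snd}
  zero_mem' := by
    intro φ _ _ _ e
    have h1 := Lp.coeFn_zero ℝ 2 (volume.restrict D)
    have h2 := Lp.coeFn_zero (E d) 2 (volume.restrict D)
    have e1 : ∫ x in D, ((0 : L2Pair D).fst : E d → ℝ) x * fderiv ℝ φ x e = 0 := by
      apply integral_eq_zero_of_ae
      filter_upwards [h1] with x hx
      simp only [WithLp.zero_fst, hx, Pi.zero_apply, zero_mul]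
    have e2 : ∫ x in D, inner ℝ (((0 : L2Pair D).snd : E d → E d) x) e * φ x = 0 := by
      apply integral_eq_zero_of_ae
      filter_upwards [h2] with x hx
      simp only [WithLp.zero_snd, hx, Pi.zero_apply, inner_zero_left, zero_mul]
    rw [e1, e2, neg_zero]
  add_mem' := by
    intro p q hp hq φ h1 h2 h3 e
    have hP := hp φ h1 h2 h3 e
    have hQ := hq φ h1 h2 h3 e
    have mφ := memLp_test h1.continuous h2 D
    have mφ' := memLp_fderiv_test h1 h2 D e
    have e1 : ∫ x in D, ((p + q).fst : E d → ℝ) x * fderiv ℝ φ x e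
        = (∫ x in D, (p.fst : E d → ℝ) x * fderiv ℝ φ x e)
          + ∫ x in D, (q.fst : E d → ℝ) x * fderiv ℝ φ x e := by
      have i1 := (Lp.memLp p.fst).integrable_mul mφ'
      have i2 := (Lp.memLp q.fst).integrable_mul mφ'
      refine Eq.trans ?_ (integral_add i1 i2)
      apply integral_congr_ae
      filter_upwards [Lp.coeFn_add p.fst q.fst] with x hx
      simp only [WithLp.add_fst, hx, Pi.add_apply]
      ring
    have e2 : ∫ x in D, inner ℝ (((p + q).snd : E d → E d) x) e * φ x
        = (∫ x in D, inner ℝ ((p.snd : E d → E d) x) e * φ x)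
          + ∫ x in D, inner ℝ ((q.snd : E d → E d) x) e * φ x := by
      have i1 := ((Lp.memLp p.snd).inner_const e).integrable_mul mφ
      have i2 := ((Lp.memLp q.snd).inner_const e).integrable_mul mφ
      refine Eq.trans ?_ (integral_add i1 i2)
      apply integral_congr_ae
      filter_upwards [Lp.coeFn_add p.snd q.snd] with x hx
      simp only [WithLp.add_snd, hx, Pi.add_apply, inner_add_left]
      ring
    rw [e1, e2, hP, hQ]
    ring
  smul_mem' := by
    intro c p hp φ h1 h2 h3 e
    have hP := hp φ h1 h2 h3 e
    have e1 : ∫ x in D, ((c • p).fst : E d → ℝ) x * fderiv ℝ φ x e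
        = c * ∫ x in D, (p.fst : E d → ℝ) x * fderiv ℝ φ x e := by
      rw [← integral_const_mul]
      apply integral_congr_ae
      filter_upwards [Lp.coeFn_smul c p.fst] with x hx
      simp only [WithLp.smul_fst, hx, Pi.smul_apply, smul_eq_mul]
      ring
    have e2 : ∫ x in D, inner ℝ (((c • p).snd : E d → E d) x) e * φ x
        = c * ∫ x in D, inner ℝ ((p.snd : E d → E d) x) e * φ x := by
      rw [← integral_const_mul]
      apply integral_congr_ae
      filter_upwards [Lp.coeFn_smul c p.snd] with x hx
      simp only [WithLp.smul_snd, hx, Pi.smul_apply, real_inner_smul_left]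
      ring
    rw [e1, e2, hP]
    ring

/-- The function `u ∈ L²(D)` underlying an element of `H¹(D)`. -/
abbrev H1.val {d : ℕ} {D : Set (E d)} (u : H1 D) : Lp ℝ 2 (volume.restrict D) := u.1.fst

/-- The weak gradient `∇u ∈ L²(D)^d` of an element of `H¹(D)`. -/
abbrev H1.grad {d : ℕ} {D : Set (E d)} (u : H1 D) : Lp (E d) 2 (volume.restrict D) := u.1.snd

/-! ### Traces -/

/-- `L²(∂D)`. -/
abbrev BoundaryL2 {d : ℕ} (D : Set (E d)) : Type := Lp ℝ 2 (surfaceMeasure D)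

/-- `g ∈ L²(∂D)` is the trace of `u ∈ H¹(D)`: there are functions `φ_n`, smooth up to the boundary
of `D`, with `φ_n → u` in `H¹(D)` and `φ_n|_{∂D} → g` in `L²(∂D)`. On a bounded Lipschitz domain
each `u ∈ H¹(D)` has exactly one trace. -/
def IsTrace {d : ℕ} {D : Set (E d)} (u : H1 D) (g : BoundaryL2 D) : Prop :=
  ∃ φ : ℕ → E d → ℝ, (∀ n, ContDiff ℝ ∞ (φ n)) ∧
    Tendsto (fun n => eLpNorm (fun x => φ n x - H1.val u x) 2 (volume.restrict D)) atTop (𝓝 0) ∧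
    Tendsto (fun n => eLpNorm (fun x => gradient (φ n) x - H1.grad u x) 2 (volume.restrict D))
      atTop (𝓝 0) ∧
    Tendsto (fun n => eLpNorm (fun x => φ n x - g x) 2 (surfaceMeasure D)) atTop (𝓝 0)

theorem IsTrace.zero {d : ℕ} (D : Set (E d)) : IsTrace (0 : H1 D) 0 := by
  refine ⟨fun _ _ => 0, fun _ => contDiff_const, ?_, ?_, ?_⟩
  · refine tendsto_const_nhds.congr fun n => ?_
    rw [eLpNorm_congr_ae (g := 0), eLpNorm_zero]
    filter_upwards [Lp.coeFn_zero ℝ 2 (volume.restrict D)] with x hx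
    have : H1.val (0 : H1 D) = 0 := rfl
    simp only [this, hx, Pi.zero_apply, sub_zero]
  · refine tendsto_const_nhds.congr fun n => ?_
    rw [eLpNorm_congr_ae (g := 0), eLpNorm_zero]
    filter_upwards [Lp.coeFn_zero (E d) 2 (volume.restrict D)] with x hx
    have : H1.grad (0 : H1 D) = 0 := rfl
    simp only [this, hx, Pi.zero_apply, sub_zero, gradient]
    simp
  · refine tendsto_const_nhds.congr fun n => ?_
    rw [eLpNorm_congr_ae (g := 0), eLpNorm_zero]
    filter_upwards [Lp.coeFn_zero ℝ 2 (surfaceMeasure D)] with x hx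
    simp only [hx, Pi.zero_apply, sub_zero]

theorem tendsto_eLpNorm_add {α F : Type*} [MeasurableSpace α] [NormedAddCommGroup F]
    {μ : Measure α} {f g : ℕ → α → F} {h : ℕ → α → F}
    (hf : ∀ n, AEStronglyMeasurable (f n) μ) (hg : ∀ n, AEStronglyMeasurable (g n) μ)
    (hh : ∀ n, h n =ᵐ[μ] f n + g n)
    (h1 : Tendsto (fun n => eLpNorm (f n) 2 μ) atTop (𝓝 0))
    (h2 : Tendsto (fun n => eLpNorm (g n) 2 μ) atTop (𝓝 0)) :
    Tendsto (fun n => eLpNorm (h n) 2 μ) atTop (𝓝 0) := by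
  have h3 := h1.add h2
  rw [add_zero] at h3
  refine tendsto_of_tendsto_of_tendsto_of_le_of_le tendsto_const_nhds h3 (fun _ => zero_le) ?_
  intro n
  beta_reduce
  rw [eLpNorm_congr_ae (hh n)]
  exact eLpNorm_add_le (hf n) (hg n) (by norm_num)

theorem tendsto_eLpNorm_smul {α F : Type*} [MeasurableSpace α] [NormedAddCommGroup F]
    [NormedSpace ℝ F] {μ : Measure α} {f h : ℕ → α → F} (c : ℝ)
    (hh : ∀ n, h n =ᵐ[μ] c • f n)
    (h1 : Tendsto (fun n => eLpNorm (f n) 2 μ) atTop (𝓝 0)) :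
    Tendsto (fun n => eLpNorm (h n) 2 μ) atTop (𝓝 0) := by
  have h3 := ENNReal.Tendsto.const_mul (a := ‖c‖ₑ) h1 (Or.inr (by simp))
  rw [mul_zero] at h3
  refine h3.congr fun n => ?_
  rw [eLpNorm_congr_ae (hh n), eLpNorm_const_smul]

theorem continuous_gradient {d : ℕ} {φ : E d → ℝ} (hφ : ContDiff ℝ ∞ φ) :
    Continuous (gradient φ) :=
  (InnerProductSpace.toDual ℝ (E d)).symm.continuous.comp (hφ.continuous_fderiv (by simp))

theorem IsTrace.add {d : ℕ} {D : Set (E d)} {u v : H1 D} {g h : BoundaryL2 D}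
    (hu : IsTrace u g) (hv : IsTrace v h) : IsTrace (u + v) (g + h) := by
  obtain ⟨φ, hφ, a1, a2, a3⟩ := hu
  obtain ⟨ψ, hψ, b1, b2, b3⟩ := hv
  refine ⟨fun n => φ n + ψ n, fun n => (hφ n).add (hψ n), ?_, ?_, ?_⟩
  · refine tendsto_eLpNorm_add (fun n => ?_) (fun n => ?_) (fun n => ?_) a1 b1
    · exact (hφ n).continuous.aestronglyMeasurable.sub (Lp.aestronglyMeasurable _)
    · exact (hψ n).continuous.aestronglyMeasurable.sub (Lp.aestronglyMeasurable _)
    · filter_upwards [Lp.coeFn_add (H1.val u) (H1.val v)] with x hx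
      have : H1.val (u + v) = H1.val u + H1.val v := rfl
      simp only [this, hx, Pi.add_apply]
      ring
  · refine tendsto_eLpNorm_add (fun n => ?_) (fun n => ?_) (fun n => ?_) a2 b2
    · exact (continuous_gradient (hφ n)).aestronglyMeasurable.sub (Lp.aestronglyMeasurable _)
    · exact (continuous_gradient (hψ n)).aestronglyMeasurable.sub (Lp.aestronglyMeasurable _)
    · filter_upwards [Lp.coeFn_add (H1.grad u) (H1.grad v)] with x hx
      have : H1.grad (u + v) = H1.grad u + H1.grad v := rfl
      have hd : gradient (φ n + ψ n) x = gradient (φ n) x + gradient (ψ n) x := by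
        simp only [gradient]
        rw [fderiv_add ((hφ n).differentiable (by simp) x) ((hψ n).differentiable (by simp) x),
          map_add]
      simp only [this, hx, Pi.add_apply, hd]
      abel
  · refine tendsto_eLpNorm_add (fun n => ?_) (fun n => ?_) (fun n => ?_) a3 b3
    · exact (hφ n).continuous.aestronglyMeasurable.sub (Lp.aestronglyMeasurable _)
    · exact (hψ n).continuous.aestronglyMeasurable.sub (Lp.aestronglyMeasurable _)
    · filter_upwards [Lp.coeFn_add g h] with x hx
      simp only [hx, Pi.add_apply]
      ring

theorem IsTrace.smul {d : ℕ} {D : Set (E d)} {u : H1 D} {g : BoundaryL2 D} (c : ℝ)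
    (hu : IsTrace u g) : IsTrace (c • u) (c • g) := by
  obtain ⟨φ, hφ, a1, a2, a3⟩ := hu
  refine ⟨fun n => c • φ n, fun n => contDiff_const.smul (hφ n), ?_, ?_, ?_⟩
  · refine tendsto_eLpNorm_smul c (fun n => ?_) a1
    filter_upwards [Lp.coeFn_smul c (H1.val u)] with x hx
    have : H1.val (c • u) = c • H1.val u := rfl
    simp only [this, hx, Pi.smul_apply, smul_eq_mul]
    ring
  · refine tendsto_eLpNorm_smul c (fun n => ?_) a2
    filter_upwards [Lp.coeFn_smul c (H1.grad u)] with x hx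
    have : H1.grad (c • u) = c • H1.grad u := rfl
    have hd : gradient (c • φ n) x = c • gradient (φ n) x := by
      simp only [gradient]
      rw [fderiv_const_smul ((hφ n).differentiable (by simp) x)]
      simp
    simp only [this, hx, Pi.smul_apply, hd, smul_sub]
  · refine tendsto_eLpNorm_smul c (fun n => ?_) a3
    filter_upwards [Lp.coeFn_smul c g] with x hx
    simp only [hx, Pi.smul_apply, smul_eq_mul]
    ring

open Classical in
/-- The trace operator `H¹(D) → L²(∂D)`. -/
def trace {d : ℕ} {D : Set (E d)} (u : H1 D) : BoundaryL2 D :=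
  if h : ∃ g, IsTrace u g then h.choose else 0

/-- `V = {v ∈ H¹(D) : v = 0 on Γ₁}` (in the sense of traces), with the inner product of `H¹(D)`. -/
def V {d : ℕ} (D Γ₁ : Set (E d)) : Submodule ℝ (H1 D) where
  carrier := {u | ∃ g : BoundaryL2 D, IsTrace u g ∧ ∀ᵐ x ∂((surfaceMeasure D).restrict Γ₁), g x = 0}
  zero_mem' := by
    refine ⟨0, IsTrace.zero D, ae_restrict_of_ae ?_⟩
    filter_upwards [Lp.coeFn_zero ℝ 2 (surfaceMeasure D)] with x hx
    simp only [hx, Pi.zero_apply]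
  add_mem' := by
    rintro u v ⟨g, hg, hg0⟩ ⟨h, hh, hh0⟩
    refine ⟨g + h, hg.add hh, ?_⟩
    filter_upwards [ae_restrict_of_ae (Lp.coeFn_add g h), hg0, hh0] with x hx h1 h2
    simp only [hx, Pi.add_apply, h1, h2, add_zero]
  smul_mem' := by
    rintro c u ⟨g, hg, hg0⟩
    refine ⟨c • g, hg.smul c, ?_⟩
    filter_upwards [ae_restrict_of_ae (Lp.coeFn_smul c g), hg0] with x hx h1
    simp only [hx, Pi.smul_apply, h1, smul_zero]

instance instNormedAddCommGroupV {d : ℕ} (D Γ₁ : Set (E d)) : NormedAddCommGroup (V D Γ₁) :=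
  (V D Γ₁).normedAddCommGroup

instance instInnerProductSpaceV {d : ℕ} (D Γ₁ : Set (E d)) : InnerProductSpace ℝ (V D Γ₁) :=
  (V D Γ₁).innerProductSpace

instance instNormedSpaceV {d : ℕ} (D Γ₁ : Set (E d)) : NormedSpace ℝ (V D Γ₁) :=
  (V D Γ₁).normedSpace

/-! ### Constraint sets and conditions on the data -/

/-- `v ≥ 0` a.e. in `D`. -/
def NonnegIn {d : ℕ} {D Γ₁ : Set (E d)} (v : V D Γ₁) : Prop :=
  ∀ᵐ x ∂(volume.restrict D), 0 ≤ H1.val v.1 x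

/-- `v = b` a.e. on `Γ₂` (in the sense of traces). -/
def EqOnBoundary {d : ℕ} {D Γ₁ : Set (E d)} (Γ₂ : Set (E d)) (b : E d → ℝ) (v : V D Γ₁) : Prop :=
  ∀ᵐ x ∂((surfaceMeasure D).restrict Γ₂), trace v.1 x = b x

/-- `K = {v ∈ V : v ≥ 0 in D, v = b on Γ₂}`. -/
def K {d : ℕ} (D Γ₁ Γ₂ : Set (E d)) (b : E d → ℝ) : Set (V D Γ₁) :=
  {v | NonnegIn v ∧ EqOnBoundary Γ₂ b v}

/-- `K̃ = {v ∈ V : v ≥ 0 in D}`. -/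
def Ktilde {d : ℕ} (D Γ₁ : Set (E d)) : Set (V D Γ₁) :=
  {v | NonnegIn v}

/-- `b ∈ L²(Γ₂)`, and `b` is the trace on `Γ₂` of some `u_b ∈ V` with `u_b ≥ 0` in `D`.
Only the values of `b` on `Γ₂` matter. -/
structure ConditionB {d : ℕ} (D Γ₁ Γ₂ : Set (E d)) (b : E d → ℝ) : Prop where
  memLp : MemLp b 2 ((surfaceMeasure D).restrict Γ₂)
  exists_lift : ∃ u_b : V D Γ₁, NonnegIn u_b ∧ EqOnBoundary Γ₂ b u_b

/-- The conditions on `p₂ : Γ₂ × ℝ → ℝ`. Only the values of `p₂` on `Γ₂ × ℝ` matter. -/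
structure ConditionP {d : ℕ} (D Γ₂ : Set (E d)) (p₂ : E d → ℝ → ℝ) : Prop where
  lipschitz : ∃ L₂ : ℝ, 0 < L₂ ∧ ∀ᵐ x ∂((surfaceMeasure D).restrict Γ₂),
    ∀ r s : ℝ, |p₂ x r - p₂ x s| ≤ L₂ * |r - s|
  monotone : ∀ᵐ x ∂((surfaceMeasure D).restrict Γ₂),
    ∀ r s : ℝ, 0 ≤ (p₂ x r - p₂ x s) * (r - s)
  measurable : ∀ r : ℝ, AEMeasurable (fun x => p₂ x r) ((surfaceMeasure D).restrict Γ₂)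
  eq_zero_iff : ∀ᵐ x ∂((surfaceMeasure D).restrict Γ₂), ∀ r : ℝ, p₂ x r = 0 ↔ r = 0

/-! ### Operators from a normed space to its dual -/

section Operators

variable {X : Type*} [NormedAddCommGroup X] [NormedSpace ℝ X]

/-- `A` maps bounded sets of `X` into bounded sets of `X*`. -/
def IsBoundedOperator (A : X → StrongDual ℝ X) : Prop :=
  ∀ S : Set X, Bornology.IsBounded S → Bornology.IsBounded (A '' S)

/-- `u_n → u` in `X` implies `A u_n ⇀ A u` weakly in `X*`. -/
def IsDemicontinuous (A : X → StrongDual ℝ X) : Prop :=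
  ∀ (u : ℕ → X) (u₀ : X), Tendsto u atTop (𝓝 u₀) →
    Tendsto (fun n => toWeakSpace ℝ (StrongDual ℝ X) (A (u n))) atTop
      (𝓝 (toWeakSpace ℝ (StrongDual ℝ X) (A u₀)))

/-- `⟨A u - A v, u - v⟩ ≥ 0` for all `u, v`. -/
def IsMonotoneOperator (A : X → StrongDual ℝ X) : Prop :=
  ∀ u v : X, 0 ≤ (A u - A v) (u - v)

/-- `Kt` is a closed convex subset of `X` containing `K`. -/
structure ConditionKtilde (K Kt : Set X) : Prop where
  isClosed : IsClosed Kt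
  convex : Convex ℝ Kt
  subset : K ⊆ Kt

/-- The conditions required of a penalty operator `G` relative to the sets `K ⊆ Kt`. -/
structure ConditionG (K Kt : Set X) (G : X → StrongDual ℝ X) : Prop where
  bounded : IsBoundedOperator G
  demicontinuous : IsDemicontinuous G
  monotone : IsMonotoneOperator G
  nonpos : ∀ u ∈ Kt, ∀ v ∈ K, G u (v - u) ≤ 0
  mem_of_eq_zero : ∀ u ∈ Kt, (∀ v ∈ K, G u (v - u) = 0) → u ∈ K

end Operators

end HeatTransfer

end

/-! Everything rests on one analytic fact: the trace is a bounded linear map T from V into L²(Γ₂).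
For smooth functions the trace inequality on a Lipschitz boundary comes from integrating along
segments that enter D transversally to a local graph, then from Fubini and compactness of ∂D
(`exists_lintegral_surfaceMeasure_le`). It passes to limits of smooth approximations, so traces are
unique and `trace` is linear and bounded on V (`traceCLM`).

The rest is pointwise. With w = T u - b, the Lipschitz bound and p₂(x,0) = 0 put p₂(·, w) in L²(Γ₂),
and G u is T* applied to it. So G is Lipschitz in norm, which gives boundedness and demicontinuity;
monotonicity is inherited from p₂. For v in K, T v = b, hence ⟨G u, v - u⟩ = -∫ p₂(x,w) w ≤ 0. If
this vanishes, the nonnegative function p₂(x,w) w is zero a.e., so w = 0 and u satisfies the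
boundary condition of K. -/

namespace HeatTransfer

/-! ### Estimates along a line and the geometry of a Lipschitz graph -/

/-- One-dimensional trace inequality. -/
theorem ofReal_sq_le_lintegral {f f' : ℝ → ℝ} (hf : ∀ t, HasDerivAt f (f' t) t)
    (hf' : Continuous f') {δ : ℝ} (hδ : 0 < δ) :
    ENNReal.ofReal (f 0 ^ 2) ≤
      ENNReal.ofReal ((1 + δ) / δ) * ∫⁻ t in Ioo 0 δ, ENNReal.ofReal (f t ^ 2 + f' t ^ 2) := by
  have hfc : Continuous f := continuous_iff_continuousAt.2 fun t => (hf t).continuousAt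
  -- The weight t - δ vanishes at δ, so only the boundary term δ f(0)² survives integration.
  have hd : ∀ t, HasDerivAt (fun t => (t - δ) * f t ^ 2) (f t ^ 2 + (t - δ) * (2 * f t * f' t)) t := by
    intro t
    have h := ((hasDerivAt_id t).sub_const δ).mul ((hf t).pow 2)
    refine h.congr_deriv ?_
    simp only [id_eq, Nat.cast_ofNat, Nat.add_one_sub_one, pow_one, one_mul, Pi.pow_apply]
  have h1 : ∫ t in (0 : ℝ)..δ, (f t ^ 2 + (t - δ) * (2 * f t * f' t)) = δ * f 0 ^ 2 := by
    rw [intervalIntegral.integral_eq_sub_of_hasDerivAt (fun t _ => hd t)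
      (Continuous.intervalIntegrable (by fun_prop) _ _)]
    ring
  have h2 : δ * f 0 ^ 2 ≤ ∫ t in (0 : ℝ)..δ, (1 + δ) * (f t ^ 2 + f' t ^ 2) := by
    rw [← h1]
    refine intervalIntegral.integral_mono_on hδ.le
      (Continuous.intervalIntegrable (by fun_prop) _ _)
      (Continuous.intervalIntegrable (by fun_prop) _ _) fun t ht => ?_
    -- The difference of the two sides is exactly (δ - t)(f + f')² + t(f² + f'²) + f'².
    nlinarith [mul_nonneg (sub_nonneg.2 ht.2) (sq_nonneg (f t + f' t)),
      mul_nonneg ht.1 (add_nonneg (sq_nonneg (f t)) (sq_nonneg (f' t))), sq_nonneg (f' t)]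
  rw [intervalIntegral.integral_const_mul, intervalIntegral.integral_of_le hδ.le,
    integral_Ioc_eq_integral_Ioo] at h2
  have hi : IntegrableOn (fun t => f t ^ 2 + f' t ^ 2) (Ioo 0 δ) :=
    (Continuous.integrableOn_Icc (by fun_prop)).mono_set Ioo_subset_Icc_self
  rw [← ofReal_integral_eq_lintegral_ofReal hi (ae_of_all _ fun t => by positivity),
    ← ENNReal.ofReal_mul (by positivity)]
  refine ENNReal.ofReal_le_ofReal ?_
  rw [div_mul_eq_mul_div, le_div_iff₀ hδ]
  linarith

/-- Fubini's theorem along a unit vector and its orthogonal complement. -/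
theorem lintegral_orthogonal_lintegral {d : ℕ} {ξ : E d} (hξ : ‖ξ‖ = 1) {h : E d → ℝ≥0∞}
    (hh : Measurable h) :
    ∫⁻ y : ((ℝ ∙ ξ)ᗮ : Submodule ℝ (E d)), ∫⁻ t : ℝ, h (y + t • ξ) = ∫⁻ x, h x := by
  have m1 := ((ℝ ∙ ξ).measurePreserving_measurableEquivProd (0 : E d)).symm
  rw [InnerProductSpace.euclideanHausdorffMeasure_eq_volume] at m1
  have m2 := (LinearIsometryEquiv.toSpanUnitSingleton (𝕜 := ℝ) ξ hξ).measurePreserving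
  rw [← m1.lintegral_comp hh]
  rw [Measure.volume_eq_prod, lintegral_prod_symm]
  · refine lintegral_congr fun y => ?_
    rw [← m2.lintegral_comp (f := fun t => h ((((ℝ ∙ ξ).measurableEquivProd 0).symm) (t, y)))
      (hh.comp (((ℝ ∙ ξ).measurableEquivProd 0).symm.measurable.comp measurable_prodMk_right))]
    refine lintegral_congr fun t => ?_
    simp [add_comm]
  · exact (hh.comp (MeasurableEquiv.measurable _)).aemeasurable

/-- Near a boundary point, the boundary of a Lipschitz domain is contained in a graph. -/
theorem eq_inner_of_mem_frontier {d : ℕ} {D : Set (E d)} (hD : IsOpen D) {x₀ ξ : E d} {r : ℝ}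
    {g : ((ℝ ∙ ξ)ᗮ : Submodule ℝ (E d)) → ℝ} (hg : Continuous g)
    (h : ∀ x ∈ Metric.ball x₀ r,
      (x ∈ D ↔ g ((ℝ ∙ ξ)ᗮ.orthogonalProjectionOnto x) < inner ℝ ξ x))
    {x : E d} (hx : x ∈ frontier D) (hxr : x ∈ Metric.ball x₀ r) :
    g ((ℝ ∙ ξ)ᗮ.orthogonalProjectionOnto x) = inner ℝ ξ x := by
  rw [hD.frontier_eq] at hx
  refine le_antisymm ?_ (not_lt.1 fun hlt => hx.2 ((h x hxr).2 hlt))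
  by_contra! hlt
  -- Being strictly below the graph is an open condition that excludes D near x, so such an x could
  -- not lie in the closure of D.
  have ho : IsOpen {z : E d | inner ℝ ξ z < g ((ℝ ∙ ξ)ᗮ.orthogonalProjectionOnto z)} :=
    isOpen_lt (by fun_prop) (by fun_prop)
  obtain ⟨z, hz, hzD⟩ := mem_closure_iff.1 hx.1 _ (ho.inter Metric.isOpen_ball) ⟨hlt, hxr⟩
  exact lt_asymm hz.1 ((h z hz.2).1 hzD)

theorem orthogonalProjectionOnto_add_inner_smul {d : ℕ} {ξ : E d} (hξ : ‖ξ‖ = 1) (x : E d) :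
    ((ℝ ∙ ξ)ᗮ.orthogonalProjectionOnto x : E d) + (inner ℝ ξ x : ℝ) • ξ = x := by
  have h := Submodule.starProjection_add_starProjection_orthogonal (K := ℝ ∙ ξ) x
  rw [Submodule.starProjection_unit_singleton ℝ hξ] at h
  rw [add_comm]
  exact h

theorem orthogonalProjectionOnto_add_smul {d : ℕ} {ξ : E d}
    (y : ((ℝ ∙ ξ)ᗮ : Submodule ℝ (E d))) (t : ℝ) :
    (ℝ ∙ ξ)ᗮ.orthogonalProjectionOnto ((y : E d) + t • ξ) = y := by
  have h : (ℝ ∙ ξ)ᗮ.orthogonalProjectionOnto (t • ξ) = 0 := by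
    rw [Submodule.orthogonalProjectionOnto_eq_zero_iff]
    exact Submodule.le_orthogonal_orthogonal _
      (Submodule.smul_mem _ _ (Submodule.mem_span_singleton_self ξ))
  rw [map_add, h, add_zero, Submodule.orthogonalProjectionOnto_mem_subspace_eq_self]

theorem inner_add_smul_self {d : ℕ} {ξ : E d} (hξ : ‖ξ‖ = 1)
    (y : ((ℝ ∙ ξ)ᗮ : Submodule ℝ (E d))) (t : ℝ) : inner ℝ ξ ((y : E d) + t • ξ) = t := by
  rw [inner_add_right, Submodule.mem_orthogonal_singleton_iff_inner_right.1 y.2,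
    real_inner_smul_right, real_inner_self_eq_norm_sq, hξ]
  ring

/-- The Hausdorff measure on a Lipschitz image is controlled by the Lebesgue measure. -/
theorem lintegral_euclideanHausdorffMeasure_le {F X : Type*} [NormedAddCommGroup F]
    [InnerProductSpace ℝ F] [FiniteDimensional ℝ F] [MeasurableSpace F] [BorelSpace F]
    [MetricSpace X] [MeasurableSpace X] [BorelSpace X] {Φ : F → X} {C : ℝ≥0}
    (hΦ : LipschitzWith C Φ) {S : Set X} {T : Set F} (hST : S ⊆ Φ '' T)
    {h : X → ℝ≥0∞} (hh : Measurable h) :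
    ∫⁻ x in S, h x ∂(Measure.euclideanHausdorffMeasure (Module.finrank ℝ F) : Measure X) ≤
      (C : ℝ≥0∞) ^ (Module.finrank ℝ F) * ∫⁻ y in T, h (Φ y) := by
  have key : (Measure.euclideanHausdorffMeasure (Module.finrank ℝ F) : Measure X).restrict S ≤
      ((C : ℝ≥0∞) ^ (Module.finrank ℝ F)) • (volume.restrict T).map Φ := by
    refine Measure.le_iff.2 fun A hA => ?_
    rw [Measure.restrict_apply hA, Measure.smul_apply, Measure.map_apply hΦ.continuous.measurable hA,
      Measure.restrict_apply (hΦ.continuous.measurable hA),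
      -- Lebesgue measure on F is the Hausdorff measure with the same normalising constant, which
      -- therefore cancels.
      ← InnerProductSpace.euclideanHausdorffMeasure_eq_volume,
      Measure.euclideanHausdorffMeasure_def, Measure.euclideanHausdorffMeasure_def,
      Measure.smul_apply, Measure.smul_apply, smul_comm]
    gcongr
    refine (measure_mono (t := Φ '' (Φ ⁻¹' A ∩ T)) ?_).trans ?_
    · rintro x ⟨hxA, hxS⟩
      obtain ⟨y, hy, rfl⟩ := hST hxS
      exact ⟨y, ⟨hxA, hy⟩, rfl⟩
    · have := hΦ.hausdorffMeasure_image_le (d := Module.finrank ℝ F) (by positivity) (Φ ⁻¹' A ∩ T)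
      simpa using this
  calc _ ≤ ∫⁻ x, h x ∂(((C : ℝ≥0∞) ^ (Module.finrank ℝ F)) • (volume.restrict T).map Φ) :=
        lintegral_mono' key le_rfl
    _ = _ := by
        rw [lintegral_smul_measure, lintegral_map hh hΦ.continuous.measurable, smul_eq_mul]

end HeatTransfer

/-! ### Trace inequality for smooth functions -/

namespace HeatTransfer

/-- The trace inequality near a boundary point. -/
theorem exists_lintegral_frontier_inter_ball_le {d : ℕ} {D : Set (E d)}
    (hD : IsBoundedLipschitzDomain D) {x₀ : E d} (hx₀ : x₀ ∈ frontier D) :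
    ∃ ρ > 0, ∃ C : ℝ≥0∞, C ≠ ⊤ ∧ ∀ φ : E d → ℝ, ContDiff ℝ ∞ φ →
      ∫⁻ x in frontier D ∩ Metric.ball x₀ ρ, ENNReal.ofReal (φ x ^ 2)
          ∂(Measure.euclideanHausdorffMeasure (d - 1) : Measure (E d)) ≤
        C * ∫⁻ x in D, ENNReal.ofReal (φ x ^ 2 + ‖gradient φ x‖ ^ 2) := by
  obtain ⟨ξ, r, L, g, hξ, hr, hg, hDg⟩ := hD.graph x₀ hx₀
  have hgc := hg.continuous
  have hrank : Module.finrank ℝ ((ℝ ∙ ξ)ᗮ : Submodule ℝ (E d)) = d - 1 := by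
    have h1 := (ℝ ∙ ξ).finrank_add_finrank_orthogonal
    rw [finrank_span_singleton (by rintro rfl; simp at hξ), finrank_euclideanSpace_fin] at h1
    omega
  let Φ : ((ℝ ∙ ξ)ᗮ : Submodule ℝ (E d)) → E d := fun y => y + g y • ξ
  have hΦ : LipschitzWith (1 + L) Φ := by
    have h1 : LipschitzWith L fun y => g y • ξ := by
      refine LipschitzWith.of_dist_le_mul fun y z => ?_
      rw [dist_eq_norm, ← sub_smul, norm_smul, hξ, mul_one, ← dist_eq_norm]
      exact hg.dist_le_mul y z
    exact LipschitzWith.subtype_val _ |>.add h1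
  have hΦc := hΦ.continuous
  -- Half the radius goes to the base point and half to the vertical segment, which thus stays in
  -- the ball where the graph describes D.
  set δ := r / 2 with hδ
  have hδ0 : 0 < δ := by positivity
  let T : Set ((ℝ ∙ ξ)ᗮ : Submodule ℝ (E d)) := Φ ⁻¹' Metric.ball x₀ δ
  have hT : MeasurableSet T := hΦc.measurable measurableSet_ball
  have hST : frontier D ∩ Metric.ball x₀ δ ⊆ Φ '' T := by
    rintro x ⟨hx, hxb⟩
    have hxe : Φ ((ℝ ∙ ξ)ᗮ.orthogonalProjectionOnto x) = x := by
      simp only [Φ]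
      rw [eq_inner_of_mem_frontier hD.isOpen hgc hDg hx
        (Metric.ball_subset_ball (by linarith) hxb)]
      exact orthogonalProjectionOnto_add_inner_smul hξ x
    exact ⟨_, by rwa [mem_preimage, hxe], hxe⟩
  have hTD : ∀ y ∈ T, ∀ t ∈ Ioo 0 δ, Φ y + t • ξ ∈ D := by
    intro y hy t ht
    have h1 : Φ y + t • ξ = y + (g y + t) • ξ := by simp only [Φ]; rw [add_smul, add_assoc]
    rw [hDg, h1, orthogonalProjectionOnto_add_smul, inner_add_smul_self hξ]
    · linarith [ht.1]
    · have h2 : dist (Φ y) x₀ < δ := hy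
      have h3 : dist (Φ y + t • ξ) (Φ y) = t := by
        rw [dist_eq_norm, add_sub_cancel_left, norm_smul, hξ, mul_one, Real.norm_of_nonneg ht.1.le]
      rw [Metric.mem_ball]
      linarith [dist_triangle (Φ y + t • ξ) (Φ y) x₀, ht.2]
  refine ⟨δ, hδ0, ((1 + L : ℝ≥0) : ℝ≥0∞) ^ (d - 1) * ENNReal.ofReal ((1 + δ) / δ),
    ENNReal.mul_ne_top (ENNReal.pow_ne_top ENNReal.coe_ne_top) ENNReal.ofReal_ne_top,
    fun φ hφ => ?_⟩
  set h : E d → ℝ≥0∞ := fun x => ENNReal.ofReal (φ x ^ 2 + ‖gradient φ x‖ ^ 2) with hh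
  have hgrad := continuous_gradient hφ
  have hφc := hφ.continuous
  have hhm : Measurable h := by
    refine ENNReal.measurable_ofReal.comp (Continuous.measurable ?_)
    fun_prop
  have hDm : MeasurableSet D := hD.isOpen.measurableSet
  have hline : ∀ y ∈ T, ENNReal.ofReal (φ (Φ y) ^ 2) ≤
      ENNReal.ofReal ((1 + δ) / δ) * ∫⁻ t : ℝ, D.indicator h (Φ y + t • ξ) := by
    intro y hy
    have hd : ∀ t : ℝ, HasDerivAt (fun t : ℝ => φ (Φ y + t • ξ))
        (inner ℝ (gradient φ (Φ y + t • ξ)) ξ) t := by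
      intro t
      have h1 : HasDerivAt (fun t : ℝ => Φ y + t • ξ) ξ t := by
        simpa using ((hasDerivAt_id t).smul_const ξ).const_add (Φ y)
      have h2 := (hφ.differentiable (by simp) (Φ y + t • ξ)).hasFDerivAt.comp_hasDerivAt t h1
      rwa [gradient, InnerProductSpace.toDual_symm_apply]
    have h3 := ofReal_sq_le_lintegral hd (by fun_prop) hδ0
    simp only [zero_smul, add_zero] at h3
    refine h3.trans (mul_le_mul' le_rfl ?_)
    rw [← lintegral_indicator measurableSet_Ioo]
    refine lintegral_mono fun t => ?_
    by_cases ht : t ∈ Ioo 0 δ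
    swap
    · simp [indicator_of_notMem ht]
    rw [indicator_of_mem ht, indicator_of_mem (hTD y hy t ht)]
    refine ENNReal.ofReal_le_ofReal (add_le_add le_rfl ?_)
    rw [← sq_abs]
    gcongr
    simpa [hξ] using abs_real_inner_le_norm (gradient φ (Φ y + t • ξ)) ξ
  have hmain := lintegral_euclideanHausdorffMeasure_le hΦ hST
    (h := fun x => ENNReal.ofReal (φ x ^ 2))
    (ENNReal.measurable_ofReal.comp (Continuous.measurable (by fun_prop)))
  rw [hrank] at hmain
  refine hmain.trans ?_
  rw [mul_assoc]
  gcongr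
  calc ∫⁻ y in T, ENNReal.ofReal (φ (Φ y) ^ 2)
      ≤ ∫⁻ y in T, ENNReal.ofReal ((1 + δ) / δ) * ∫⁻ t : ℝ, D.indicator h (Φ y + t • ξ) :=
        setLIntegral_mono' hT hline
    _ ≤ ∫⁻ y, ENNReal.ofReal ((1 + δ) / δ) * ∫⁻ t : ℝ, D.indicator h (Φ y + t • ξ) :=
        setLIntegral_le_lintegral _ _
    _ = ENNReal.ofReal ((1 + δ) / δ) *
          ∫⁻ y : ((ℝ ∙ ξ)ᗮ : Submodule ℝ (E d)), ∫⁻ t : ℝ, D.indicator h (y + t • ξ) := by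
        rw [lintegral_const_mul' _ _ ENNReal.ofReal_ne_top]
        congr 1
        refine lintegral_congr fun y => ?_
        -- Translating t by g(y) on each vertical line flattens the graph, so no change-of-variables
        -- factor appears.
        rw [← lintegral_add_left_eq_self (fun t => D.indicator h (y + t • ξ)) (g y)]
        refine lintegral_congr fun t => ?_
        simp only [Φ]
        rw [add_smul, add_assoc]
    _ = ENNReal.ofReal ((1 + δ) / δ) * ∫⁻ x in D, h x := by
        rw [lintegral_orthogonal_lintegral hξ (hhm.indicator hDm), lintegral_indicator hDm]

/-- The trace inequality for smooth functions. -/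
theorem exists_lintegral_surfaceMeasure_le {d : ℕ} {D : Set (E d)}
    (hD : IsBoundedLipschitzDomain D) :
    ∃ C : ℝ≥0∞, C ≠ ⊤ ∧ ∀ φ : E d → ℝ, ContDiff ℝ ∞ φ →
      ∫⁻ x, ENNReal.ofReal (φ x ^ 2) ∂(surfaceMeasure D) ≤
        C * ∫⁻ x in D, ENNReal.ofReal (φ x ^ 2 + ‖gradient φ x‖ ^ 2) := by
  have hc : IsCompact (frontier D) :=
    Metric.isCompact_of_isClosed_isBounded isClosed_frontier
      (hD.isBounded.closure.subset frontier_subset_closure)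
  -- The estimate on S passes to subsets and finite unions and holds near each boundary point, hence
  -- on all of the compact boundary.
  refine hc.induction_on
    (p := fun S => ∃ C : ℝ≥0∞, C ≠ ⊤ ∧ ∀ φ : E d → ℝ, ContDiff ℝ ∞ φ →
      ∫⁻ x in S, ENNReal.ofReal (φ x ^ 2)
        ∂(Measure.euclideanHausdorffMeasure (d - 1) : Measure (E d)) ≤
        C * ∫⁻ x in D, ENNReal.ofReal (φ x ^ 2 + ‖gradient φ x‖ ^ 2)) ?_ ?_ ?_ ?_
  · exact ⟨0, ENNReal.zero_ne_top, fun φ _ => by simp⟩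
  · rintro S T hST ⟨C, hC, h⟩
    exact ⟨C, hC, fun φ hφ => (lintegral_mono_set hST).trans (h φ hφ)⟩
  · rintro S T ⟨C, hC, h⟩ ⟨C', hC', h'⟩
    refine ⟨C + C', ENNReal.add_ne_top.2 ⟨hC, hC'⟩, fun φ hφ => ?_⟩
    rw [add_mul]
    exact (lintegral_union_le _ _ _).trans (add_le_add (h φ hφ) (h' φ hφ))
  · intro x₀ hx₀
    obtain ⟨ρ, hρ, hC⟩ := exists_lintegral_frontier_inter_ball_le hD hx₀
    exact ⟨_, inter_mem_nhdsWithin _ (Metric.ball_mem_nhds x₀ hρ), hC⟩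

theorem eLpNorm_two_sq {α F : Type*} [MeasurableSpace α] [NormedAddCommGroup F] {μ : Measure α}
    (f : α → F) : eLpNorm f 2 μ ^ 2 = ∫⁻ x, ENNReal.ofReal (‖f x‖ ^ 2) ∂μ := by
  have h := eLpNorm_nnreal_pow_eq_lintegral (f := f) (μ := μ) (p := 2) (by norm_num)
  norm_num at h
  rw [h]
  refine lintegral_congr fun x => ?_
  rw [ENNReal.ofReal_pow (norm_nonneg _), ofReal_norm]

theorem exists_eLpNorm_surfaceMeasure_le {d : ℕ} {D : Set (E d)}
    (hD : IsBoundedLipschitzDomain D) :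
    ∃ C : ℝ≥0, ∀ φ : E d → ℝ, ContDiff ℝ ∞ φ →
      eLpNorm φ 2 (surfaceMeasure D) ≤ C * (eLpNorm φ 2 (volume.restrict D) +
        eLpNorm (gradient φ) 2 (volume.restrict D)) := by
  obtain ⟨C, hC, h⟩ := exists_lintegral_surfaceMeasure_le hD
  lift C to ℝ≥0 using hC
  -- After squaring, C ≤ (1 + C)² and a² + b² ≤ (a + b)² suffice, which avoids square roots.
  refine ⟨1 + C, fun φ hφ => ?_⟩
  rw [← ENNReal.pow_le_pow_left_iff two_ne_zero, mul_pow]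
  have h1 := h φ hφ
  have h2 : ∫⁻ x in D, ENNReal.ofReal (φ x ^ 2 + ‖gradient φ x‖ ^ 2) =
      eLpNorm φ 2 (volume.restrict D) ^ 2 + eLpNorm (gradient φ) 2 (volume.restrict D) ^ 2 := by
    rw [eLpNorm_two_sq, eLpNorm_two_sq, ← lintegral_add_left]
    · refine lintegral_congr fun x => ?_
      rw [ENNReal.ofReal_add (by positivity) (by positivity), Real.norm_eq_abs, sq_abs]
    · exact ENNReal.measurable_ofReal.comp (hφ.continuous.norm.pow 2).measurable
  rw [h2] at h1
  have h3 : eLpNorm φ 2 (surfaceMeasure D) ^ 2 = ∫⁻ x, ENNReal.ofReal (φ x ^ 2) ∂(surfaceMeasure D) := by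
    rw [eLpNorm_two_sq]
    simp
  rw [h3]
  refine h1.trans ?_
  gcongr
  · have : (C : ℝ≥0) ≤ (1 + C) ^ 2 := by nlinarith [C.2, sq_nonneg (C : ℝ), zero_le (a := C ^ 2)]
    exact_mod_cast this
  · rw [add_sq]
    gcongr
    exact le_self_add

end HeatTransfer

/-! ### The trace operator on V -/

noncomputable section

namespace HeatTransfer

/-- The smooth inequality is passed to the limit along the sequence defining the trace. Quantifying
over every trace g yields both uniqueness and continuity. -/
theorem exists_forall_isTrace_norm_le {d : ℕ} {D : Set (E d)} (hD : IsBoundedLipschitzDomain D) :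
    ∃ C : ℝ, ∀ (u : H1 D) (g : BoundaryL2 D), IsTrace u g → ‖g‖ ≤ C * ‖u‖ := by
  obtain ⟨C, hC⟩ := exists_eLpNorm_surfaceMeasure_le hD
  -- The factor 2 arises because u and ∇u each have norm at most ‖u‖.
  refine ⟨2 * C, fun u g hg => ?_⟩
  obtain ⟨φ, hφ, a1, a2, a3⟩ := hg
  have hn : ∀ n, eLpNorm g 2 (surfaceMeasure D) ≤
      C * ((eLpNorm (fun x => φ n x - H1.val u x) 2 (volume.restrict D) +
          eLpNorm (H1.val u) 2 (volume.restrict D)) +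
        (eLpNorm (fun x => gradient (φ n) x - H1.grad u x) 2 (volume.restrict D) +
          eLpNorm (H1.grad u) 2 (volume.restrict D))) +
      eLpNorm (fun x => φ n x - g x) 2 (surfaceMeasure D) := by
    intro n
    have hc := (hφ n).continuous
    have hgc := continuous_gradient (hφ n)
    have h1 : eLpNorm (φ n) 2 (volume.restrict D) ≤
        eLpNorm (fun x => φ n x - H1.val u x) 2 (volume.restrict D) +
          eLpNorm (H1.val u) 2 (volume.restrict D) := by
      refine le_trans (le_of_eq ?_) (eLpNorm_add_le
        (hc.aestronglyMeasurable.sub (Lp.aestronglyMeasurable _)) (Lp.aestronglyMeasurable _)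
        one_le_two)
      congr 1
      ext x
      simp
    have h2 : eLpNorm (gradient (φ n)) 2 (volume.restrict D) ≤
        eLpNorm (fun x => gradient (φ n) x - H1.grad u x) 2 (volume.restrict D) +
          eLpNorm (H1.grad u) 2 (volume.restrict D) := by
      refine le_trans (le_of_eq ?_) (eLpNorm_add_le
        (hgc.aestronglyMeasurable.sub (Lp.aestronglyMeasurable _)) (Lp.aestronglyMeasurable _)
        one_le_two)
      congr 1
      ext x
      simp
    have h3 : eLpNorm g 2 (surfaceMeasure D) ≤ eLpNorm (φ n) 2 (surfaceMeasure D) +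
        eLpNorm (fun x => φ n x - g x) 2 (surfaceMeasure D) := by
      refine le_trans (le_of_eq ?_) (eLpNorm_sub_le hc.aestronglyMeasurable
        (hc.aestronglyMeasurable.sub (Lp.aestronglyMeasurable g)) one_le_two)
      congr 1
      ext x
      simp
    refine h3.trans (add_le_add ((hC _ (hφ n)).trans ?_) le_rfl)
    gcongr
  have hlim := ((ENNReal.Tendsto.const_mul ((a1.add_const (eLpNorm (H1.val u) 2 (volume.restrict D))).add
    (a2.add_const (eLpNorm (H1.grad u) 2 (volume.restrict D))))
      (Or.inr (ENNReal.coe_ne_top (r := C))))).add a3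
  have h := ge_of_tendsto' hlim hn
  rw [zero_add, zero_add, add_zero] at h
  have h1 : ‖g‖ ≤ C * (‖H1.val u‖ + ‖H1.grad u‖) := by
    rw [Lp.norm_def, Lp.norm_def, Lp.norm_def, ← ENNReal.toReal_add (Lp.eLpNorm_ne_top _)
      (Lp.eLpNorm_ne_top _), ← ENNReal.coe_toReal, ← ENNReal.toReal_mul]
    exact ENNReal.toReal_mono (ENNReal.mul_ne_top ENNReal.coe_ne_top
      (ENNReal.add_ne_top.2 ⟨Lp.eLpNorm_ne_top _, Lp.eLpNorm_ne_top _⟩)) h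
  have h2 : ‖H1.val u‖ ≤ ‖u‖ := WithLp.norm_fst_le _ u.1
  have h3 : ‖H1.grad u‖ ≤ ‖u‖ := WithLp.norm_snd_le _ u.1
  nlinarith [C.2]

/-- The difference of two traces of u is a trace of 0, and the norm bound forces it to vanish. -/
theorem IsTrace.unique {d : ℕ} {D : Set (E d)} (hD : IsBoundedLipschitzDomain D) {u : H1 D}
    {g h : BoundaryL2 D} (hg : IsTrace u g) (hh : IsTrace u h) : g = h := by
  obtain ⟨C, hC⟩ := exists_forall_isTrace_norm_le hD
  have h1 := hC _ _ (hg.add (hh.smul (-1)))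
  simp only [neg_smul, one_smul, add_neg_cancel, norm_zero, mul_zero, ← sub_eq_add_neg] at h1
  exact sub_eq_zero.1 (norm_le_zero_iff.1 h1)

/-- Membership in `V` provides a trace, so the default value 0 in `trace` is never reached here. -/
theorem isTrace_trace {d : ℕ} {D Γ₁ : Set (E d)} (u : V D Γ₁) : IsTrace u.1 (trace u.1) := by
  obtain ⟨g, hg, -⟩ := u.2
  have h : ∃ g, IsTrace u.1 g := ⟨g, hg⟩
  rw [trace, dif_pos h]
  exact h.choose_spec

/-- The trace operator on `V`, as a continuous linear map into `L²(Γ₂)`. -/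
def traceCLM {d : ℕ} {D : Set (E d)} (hD : IsBoundedLipschitzDomain D) (Γ₁ Γ₂ : Set (E d)) :
    V D Γ₁ →L[ℝ] Lp ℝ 2 ((surfaceMeasure D).restrict Γ₂) :=
  LpToLpRestrictCLM (E d) ℝ ℝ (surfaceMeasure D) 2 Γ₂ ∘L
    LinearMap.mkContinuous
      { toFun := fun u => trace u.1
        map_add' := fun u v => (isTrace_trace (u + v)).unique hD
          ((isTrace_trace u).add (isTrace_trace v))
        map_smul' := fun c u => (isTrace_trace (c • u)).unique hD ((isTrace_trace u).smul c) }
      (exists_forall_isTrace_norm_le hD).choose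
      fun u => (exists_forall_isTrace_norm_le hD).choose_spec _ _ (isTrace_trace u)

theorem traceCLM_coeFn {d : ℕ} {D : Set (E d)} (hD : IsBoundedLipschitzDomain D)
    (Γ₁ Γ₂ : Set (E d)) (u : V D Γ₁) :
    traceCLM hD Γ₁ Γ₂ u =ᵐ[(surfaceMeasure D).restrict Γ₂] trace u.1 :=
  LpToLpRestrictCLM_coeFn ℝ Γ₂ (trace u.1)

/-! ### Superposition by p₂ -/

/-- Superposition of a Carathéodory function with a measurable function. -/
theorem aemeasurable_comp_of_ae_continuous {α : Type*} [MeasurableSpace α] {μ : Measure α}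
    {p : α → ℝ → ℝ} (hm : ∀ r, AEMeasurable (fun x => p x r) μ)
    (hc : ∀ᵐ x ∂μ, Continuous (p x)) {f : α → ℝ} (hf : AEMeasurable f μ) :
    AEMeasurable (fun x => p x (f x)) μ := by
  have hF := hf.measurable_mk
  set F := hf.mk f
  let s := SimpleFunc.approxOn F hF univ 0 (mem_univ _)
  have hs : ∀ n, AEMeasurable (fun x => p x (s n x)) μ := by
    intro n
    -- A simple function has finite range, so measurability of p(·, r) for each fixed r is enough;
    -- continuity in r handles the limit.
    have h1 : (fun x => p x (s n x)) =
        fun x => ∑ r ∈ (s n).range, (s n ⁻¹' {r}).indicator (fun x => p x r) x := by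
      ext x
      rw [Finset.sum_eq_single (s n x)]
      · simp
      · intro r _ hr
        exact indicator_of_notMem (fun h => hr h.symm) _
      · intro h
        exact absurd (SimpleFunc.mem_range_self (s n) x) h
    rw [h1]
    exact Finset.aemeasurable_fun_sum _ fun r _ => (hm r).indicator ((s n).measurableSet_fiber r)
  refine aemeasurable_of_tendsto_metrizable_ae' hs ?_
  filter_upwards [hc, hf.ae_eq_mk] with x hx hfx
  rw [hfx]
  exact (hx.tendsto _).comp (SimpleFunc.tendsto_approxOn hF (mem_univ _) (by simp))

/-- The function `x ↦ p₂(x, u(x) - b(x))` is in `L²(Γ₂)`. -/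
theorem memLp_penalty {d : ℕ} {D Γ₂ : Set (E d)} {p₂ : E d → ℝ → ℝ} (hp : ConditionP D Γ₂ p₂)
    {b f : E d → ℝ} (hb : MemLp b 2 ((surfaceMeasure D).restrict Γ₂))
    (hf : MemLp f 2 ((surfaceMeasure D).restrict Γ₂)) :
    MemLp (fun x => p₂ x (f x - b x)) 2 ((surfaceMeasure D).restrict Γ₂) := by
  obtain ⟨L, hL, hlip⟩ := hp.lipschitz
  refine MemLp.of_le_mul (c := L) (hf.sub hb)
    (aemeasurable_comp_of_ae_continuous hp.measurable ?_
      (hf.sub hb).aestronglyMeasurable.aemeasurable).aestronglyMeasurable ?_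
  · filter_upwards [hlip] with x hx
    exact (LipschitzWith.of_dist_le_mul (K := ⟨L, hL.le⟩) fun r s => hx r s).continuous
  · filter_upwards [hlip, hp.eq_zero_iff] with x hx h0
    have h := hx (f x - b x) 0
    rw [(h0 0).2 rfl, sub_zero, sub_zero] at h
    exact h

/-- Monotonicity is tested against s = 0, where p₂ vanishes. -/
theorem ConditionP.mul_self_nonneg_ae {d : ℕ} {D Γ₂ : Set (E d)} {p₂ : E d → ℝ → ℝ}
    (hp : ConditionP D Γ₂ p₂) (f : E d → ℝ) :
    ∀ᵐ x ∂((surfaceMeasure D).restrict Γ₂), 0 ≤ p₂ x (f x) * f x := by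
  filter_upwards [hp.monotone, hp.eq_zero_iff] with x h1 h2
  have h := h1 (f x) 0
  rwa [(h2 0).2 rfl, sub_zero, sub_zero] at h

/-! ### The penalty operator for an abstract bounded map T into L²(Γ₂) -/

section Penalty

variable {d : ℕ} {D Γ₂ : Set (E d)} {X : Type*} [NormedAddCommGroup X] [NormedSpace ℝ X]
  (T : X →L[ℝ] Lp ℝ 2 ((surfaceMeasure D).restrict Γ₂))
  {b : E d → ℝ} (hb : MemLp b 2 ((surfaceMeasure D).restrict Γ₂))
  {p₂ : E d → ℝ → ℝ} (hp : ConditionP D Γ₂ p₂)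

/-- The element `p₂(·, T u - b)` of `L²(Γ₂)`. -/
def penaltyLp (u : X) : Lp ℝ 2 ((surfaceMeasure D).restrict Γ₂) :=
  (memLp_penalty hp hb (Lp.memLp (T u))).toLp

theorem penaltyLp_coeFn (u : X) :
    penaltyLp T hb hp u =ᵐ[(surfaceMeasure D).restrict Γ₂] fun x => p₂ x (T u x - b x) :=
  MemLp.coeFn_toLp _

/-- The shift b cancels in differences, so the pointwise Lipschitz bound integrates to an L² bound
by T u - T v. -/
theorem exists_lipschitzWith_penaltyLp : ∃ L : ℝ≥0, LipschitzWith L (penaltyLp T hb hp) := by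
  obtain ⟨L, hL, hlip⟩ := hp.lipschitz
  lift L to ℝ≥0 using hL.le
  have h : ∀ u v, ‖penaltyLp T hb hp u - penaltyLp T hb hp v‖ ≤ L * ‖T u - T v‖ := by
    intro u v
    refine Lp.norm_le_mul_norm_of_ae_le_mul ?_
    filter_upwards [hlip, penaltyLp_coeFn T hb hp u, penaltyLp_coeFn T hb hp v,
      Lp.coeFn_sub (penaltyLp T hb hp u) (penaltyLp T hb hp v),
      Lp.coeFn_sub (T u) (T v)] with x hx h1 h2 h5 h6
    rw [h5, h6, Pi.sub_apply, Pi.sub_apply, h1, h2]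
    simpa using hx (T u x - b x) (T v x - b x)
  refine ⟨L * ‖T‖₊, LipschitzWith.of_dist_le_mul fun u v => ?_⟩
  rw [dist_eq_norm, dist_eq_norm, NNReal.coe_mul, mul_assoc]
  refine (h u v).trans ?_
  rw [← map_sub]
  exact mul_le_mul_of_nonneg_left (T.le_opNorm _) L.2

/-- The penalty operator `⟨G u, v⟩ = ∫_{Γ₂} p₂(x, T u - b) T v da`. -/
def penalty (u : X) : StrongDual ℝ X :=
  innerSL ℝ (penaltyLp T hb hp u) ∘L T

theorem integrable_penalty (hb : MemLp b 2 ((surfaceMeasure D).restrict Γ₂))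
    (hp : ConditionP D Γ₂ p₂) (u v : X) :
    Integrable (fun x => p₂ x (T u x - b x) * T v x) ((surfaceMeasure D).restrict Γ₂) :=
  (memLp_penalty hp hb (Lp.memLp (T u))).integrable_mul (Lp.memLp (T v))

theorem penalty_apply (u v : X) :
    penalty T hb hp u v = ∫ x in Γ₂, p₂ x (T u x - b x) * T v x ∂(surfaceMeasure D) := by
  simp only [penalty, ContinuousLinearMap.comp_apply, innerSL_apply_apply, L2.inner_def]
  refine integral_congr_ae ?_
  filter_upwards [penaltyLp_coeFn T hb hp u] with x h1
  rw [h1, real_inner_eq_re_inner, RCLike.inner_apply, mul_comm]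
  simp

/-- Norm Lipschitz continuity is stronger than needed, but gives boundedness and demicontinuity at
once. -/
theorem exists_lipschitzWith_penalty : ∃ L : ℝ≥0, LipschitzWith L (penalty T hb hp) := by
  obtain ⟨L, hL⟩ := exists_lipschitzWith_penaltyLp T hb hp
  refine ⟨‖T‖₊ * L, LipschitzWith.of_dist_le_mul fun u v => ?_⟩
  have h1 : penalty T hb hp u - penalty T hb hp v =
      innerSL ℝ (penaltyLp T hb hp u - penaltyLp T hb hp v) ∘L T := by
    rw [map_sub, ContinuousLinearMap.sub_comp]
    rfl
  rw [dist_eq_norm, h1]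
  refine (ContinuousLinearMap.opNorm_comp_le _ _).trans ?_
  rw [innerSL_apply_norm, ← dist_eq_norm, mul_comm, NNReal.coe_mul, mul_assoc]
  exact mul_le_mul_of_nonneg_left (hL.dist_le_mul u v) (norm_nonneg _)

theorem isBoundedOperator_penalty : IsBoundedOperator (penalty T hb hp) := by
  obtain ⟨L, hL⟩ := exists_lipschitzWith_penalty T hb hp
  exact fun S hS => hL.isBounded_image hS

theorem isDemicontinuous_penalty : IsDemicontinuous (penalty T hb hp) := by
  obtain ⟨L, hL⟩ := exists_lipschitzWith_penalty T hb hp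
  intro u u₀ hu
  exact ((toWeakSpaceCLM ℝ (StrongDual ℝ X)).continuous.tendsto _).comp
    ((hL.continuous.tendsto u₀).comp hu)

theorem isMonotoneOperator_penalty : IsMonotoneOperator (penalty T hb hp) := by
  intro u v
  rw [sub_apply, penalty_apply, penalty_apply,
    ← integral_sub (integrable_penalty T hb hp _ _) (integrable_penalty T hb hp _ _), map_sub]
  refine integral_nonneg_of_ae ?_
  filter_upwards [hp.monotone, Lp.coeFn_sub (T u) (T v)] with x hx h
  rw [h, Pi.sub_apply, Pi.zero_apply, ← sub_mul]
  simpa using hx (T u x - b x) (T v x - b x)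

/-- For `T v = b` on `Γ₂`, the integrand of `⟨G u, v - u⟩` is `-p₂(x, T u - b) (T u - b)`. -/
theorem penalty_integrand_ae (u : X) {v : X} (hv : T v =ᵐ[(surfaceMeasure D).restrict Γ₂] b) :
    (fun x => p₂ x (T u x - b x) * T (v - u) x) =ᵐ[(surfaceMeasure D).restrict Γ₂]
      fun x => -(p₂ x (T u x - b x) * (T u x - b x)) := by
  rw [map_sub]
  filter_upwards [Lp.coeFn_sub (T v) (T u), hv] with x h1 h2
  rw [h1, Pi.sub_apply, h2]
  ring

theorem penalty_apply_sub_nonpos (u : X) {v : X}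
    (hv : T v =ᵐ[(surfaceMeasure D).restrict Γ₂] b) : penalty T hb hp u (v - u) ≤ 0 := by
  rw [penalty_apply]
  refine integral_nonpos_of_ae ?_
  filter_upwards [penalty_integrand_ae T (p₂ := p₂) u hv,
    hp.mul_self_nonneg_ae fun x => T u x - b x] with x h1 h2
  rw [h1, Pi.zero_apply]
  linarith

/-- A nonnegative function with zero integral vanishes a.e.; whichever factor of p₂(x,w) w is zero,
w = 0 follows. -/
theorem ae_eq_of_penalty_apply_sub_eq_zero {u v : X}
    (hv : T v =ᵐ[(surfaceMeasure D).restrict Γ₂] b) (h : penalty T hb hp u (v - u) = 0) :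
    T u =ᵐ[(surfaceMeasure D).restrict Γ₂] b := by
  have hae := penalty_integrand_ae T (p₂ := p₂) u hv
  have hnn := hp.mul_self_nonneg_ae fun x => T u x - b x
  have hi := ((integrable_penalty T hb hp u (v - u)).congr hae).neg
  rw [penalty_apply, integral_congr_ae hae, integral_neg, neg_eq_zero,
    integral_eq_zero_iff_of_nonneg_ae hnn (by simpa [Pi.neg_def] using hi)] at h
  filter_upwards [h, hp.eq_zero_iff] with x h1 h2
  rcases mul_eq_zero.1 h1 with h3 | h3
  · exact sub_eq_zero.1 ((h2 _).1 h3)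
  · exact sub_eq_zero.1 h3

end Penalty

/-! ### The constraint sets and the conclusion -/

set_option maxHeartbeats 1000000 in
-- Closedness holds because `Ktilde` is the preimage of the closed positive cone of L²(D) under the
-- continuous map u ↦ `H1.val u`.
theorem conditionKtilde_Ktilde {d : ℕ} (D Γ₁ Γ₂ : Set (E d)) (b : E d → ℝ) :
    ConditionKtilde (K D Γ₁ Γ₂ b) (Ktilde D Γ₁) := by
  have h : Ktilde D Γ₁ = (fun v : V D Γ₁ => H1.val v.1) ⁻¹' {f | 0 ≤ f} := by
    ext v
    exact (Lp.coeFn_nonneg (H1.val v.1))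
  refine ⟨?_, ?_, fun v hv => hv.1⟩
  · rw [h]
    refine isClosed_Ici.preimage ?_
    exact (WithLp.prod_continuous_ofLp 2 _ _).fst.comp
      (continuous_subtype_val.comp continuous_subtype_val)
  · intro u hu v hv s t hs ht _
    have h1 : H1.val (s • u + t • v).1 = s • H1.val u.1 + t • H1.val v.1 := rfl
    change ∀ᵐ x ∂(volume.restrict D), 0 ≤ H1.val (s • u + t • v).1 x
    rw [h1]
    filter_upwards [hu, hv, Lp.coeFn_add (s • H1.val u.1) (t • H1.val v.1),
      Lp.coeFn_smul s (H1.val u.1), Lp.coeFn_smul t (H1.val v.1)] with x hx hx' h2 h3 h4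
    rw [h2, Pi.add_apply, h3, h4]
    exact add_nonneg (mul_nonneg hs hx) (mul_nonneg ht hx')

end HeatTransfer

end

set_option maxHeartbeats 1000000 in
theorem mainTheorem11 {d : ℕ} (hd : 1 ≤ d) (D Γ₁ Γ₂ Γ₃ : Set (HeatTransfer.E d))
    (hD : HeatTransfer.IsBoundedLipschitzDomain D)
    (hΓ : HeatTransfer.IsBoundaryPartition D Γ₁ Γ₂ Γ₃)
    (b : HeatTransfer.E d → ℝ) (hb : HeatTransfer.ConditionB D Γ₁ Γ₂ b)
    (p₂ : HeatTransfer.E d → ℝ → ℝ) (hp : HeatTransfer.ConditionP D Γ₂ p₂) :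
    HeatTransfer.ConditionKtilde (HeatTransfer.K D Γ₁ Γ₂ b) (HeatTransfer.Ktilde D Γ₁) ∧
    ∃ G : HeatTransfer.V D Γ₁ → StrongDual ℝ (HeatTransfer.V D Γ₁),
      (∀ u v : HeatTransfer.V D Γ₁,
        Integrable (fun x => p₂ x (HeatTransfer.trace u.1 x - b x) * HeatTransfer.trace v.1 x)
          ((HeatTransfer.surfaceMeasure D).restrict Γ₂) ∧
        G u v = ∫ x in Γ₂, p₂ x (HeatTransfer.trace u.1 x - b x) * HeatTransfer.trace v.1 x
          ∂(HeatTransfer.surfaceMeasure D)) ∧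
      HeatTransfer.ConditionG (HeatTransfer.K D Γ₁ Γ₂ b) (HeatTransfer.Ktilde D Γ₁) G := by
  -- The lift makes K nonempty; testing against v = `u_b` alone gives the last property of G.
  obtain ⟨u_b, hu_b, hu_b'⟩ := hb.exists_lift
  let T := HeatTransfer.traceCLM hD Γ₁ Γ₂
  have hT : ∀ u, T u =ᵐ[(HeatTransfer.surfaceMeasure D).restrict Γ₂] HeatTransfer.trace u.1 :=
    HeatTransfer.traceCLM_coeFn hD Γ₁ Γ₂
  have hae : ∀ u v : HeatTransfer.V D Γ₁, (fun x => p₂ x (T u x - b x) * T v x)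
      =ᵐ[(HeatTransfer.surfaceMeasure D).restrict Γ₂]
      fun x => p₂ x (HeatTransfer.trace u.1 x - b x) * HeatTransfer.trace v.1 x := by
    intro u v
    filter_upwards [hT u, hT v] with x h1 h2
    rw [h1, h2]
  refine ⟨HeatTransfer.conditionKtilde_Ktilde D Γ₁ Γ₂ b,
    HeatTransfer.penalty T hb.memLp hp, fun u v =>
      ⟨(HeatTransfer.integrable_penalty T hb.memLp hp u v).congr (hae u v),
        (HeatTransfer.penalty_apply T hb.memLp hp u v).trans (integral_congr_ae (hae u v))⟩,
    HeatTransfer.isBoundedOperator_penalty T hb.memLp hp,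
    HeatTransfer.isDemicontinuous_penalty T hb.memLp hp,
    HeatTransfer.isMonotoneOperator_penalty T hb.memLp hp,
    fun u _ v hv => HeatTransfer.penalty_apply_sub_nonpos T hb.memLp hp u ((hT v).trans hv.2),
    fun u hu h => ⟨hu, (hT u).symm.trans (HeatTransfer.ae_eq_of_penalty_apply_sub_eq_zero T
      hb.memLp hp ((hT u_b).trans hu_b') (h u_b ⟨hu_b, hu_b'⟩))⟩⟩
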